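/- Let $m,n\ge 1$ be integers and let $a>\tfrac12(m+1)$ be real. Let $\mathcal{P}_m$ be the cone of real symmetric positive definite $m\times m$ matrices, and let $X_1,\dots,X_n$ be i.i.d. random matrices in $\mathcal{P}_m$ with the Wishart distribution $W_m(a,I_m)$, that is, with density $$w(x)=\frac{1}{2^{ma}\,\Gamma_m(a)}(\det x)^{a-\frac12(m+1)}\exp\!\big(-\tfrac12\operatorname{tr}x\big),\qquad x\in\mathcal{P}_m,$$ with respect to Lebesgue measure $dx=\prod_{1\le i\le j\le m}dx_{ij}$, where $\Gamma_m(a)=\pi^{m(m-1)/4}\prod_{j=1}^m\Gamma\big(a-\tfrac12(j-1)\big)$. Define the random walk $$S_1=X_1,\qquad S_{j+1}=S_j^{1/2}X_{j+1}S_j^{1/2}\quad(j\ge 1),$$ and $U_n=\max\{d_R(I_m,S_1),\dots,d_R(I_m,S_n)\}$, where $d_R(A,B)=\Big(\sum_{j=1}^m\big[\log\lambda_j(A^{-1/2}BA^{-1/2})\big]^2\Big)^{1/2}$ is the Riemannian metric on $\mathcal{P}_m$ and $\lambda_1(\cdot),\dots,\lambda_m(\cdot)$ denote the eigenvalues. Let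 $R_1,\dots,R_n$ be i.i.d. random variables with the chi-squared distribution with $(2a-m-1)m$ degrees of freedom. Then, for every $t>0$, $$\mathbb{P}(U_n\le t)\le\min_{1\le j\le n}\mathbb{P}\Big(\prod_{i=1}^j R_i\le m^j\exp(t/\sqrt m)\Big).$$ In particular, $$\mathbb{P}(U_n\le t)\le\mathbb{P}\big(\chi^2_{(2a-m-1)m}\le m\exp(t/\sqrt m)\big),$$ where $\chi^2_{(2a-m-1)m}$ denotes a random variable having that chi-squared distribution. -/

import Mathlib

open MeasureTheory ProbabilityTheory
open scoped MatrixOrder ENNReal Matrix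

noncomputable section

/-- The cone of real symmetric positive definite `m × m` matrices. -/
def PDCone (m : ℕ) : Type := {A : Matrix (Fin m) (Fin m) ℝ // A.PosDef}

namespace PDCone

variable {m : ℕ}

/-- The matrix underlying a point of the cone. -/
def mat (A : PDCone m) : Matrix (Fin m) (Fin m) ℝ := A.1

/-- The topology of the cone, as a subspace of the space of matrices. -/
instance : TopologicalSpace (PDCone m) :=
  inferInstanceAs (TopologicalSpace {A : Matrix (Fin m) (Fin m) ℝ // A.PosDef})

/-- The cone carries its Borel `σ`-algebra. -/
instance : MeasurableSpace (PDCone m) := borel (PDCone m)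

instance : BorelSpace (PDCone m) := ⟨rfl⟩

/-- The identity matrix, as a point of the cone. -/
def one (m : ℕ) : PDCone m := ⟨1, Matrix.PosDef.one⟩

/-- The positive definite square root `A^{1/2}`, as a matrix. -/
def sqrtMat (A : PDCone m) : Matrix (Fin m) (Fin m) ℝ := CFC.sqrt A.mat

theorem sqrtMat_posDef (A : PDCone m) : A.sqrtMat.PosDef :=
  Matrix.isStrictlyPositive_iff_posDef.mp
    (IsStrictlyPositive.sqrt A.mat (Matrix.isStrictlyPositive_iff_posDef.mpr A.2))

theorem conj_posDef {P : Matrix (Fin m) (Fin m) ℝ} (hP : P.PosDef) (B : PDCone m) :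
    (P * B.mat * P).PosDef := by
  have h := Matrix.PosDef.conjTranspose_mul_mul_same (B := P) B.2
    (Matrix.mulVec_injective_of_isUnit hP.isUnit)
  rwa [hP.isHermitian.eq] at h

/-- The product `A ∘ B = A^{1/2} B A^{1/2}` on the cone. -/
def comp (A B : PDCone m) : PDCone m :=
  ⟨A.sqrtMat * B.mat * A.sqrtMat, conj_posDef A.sqrtMat_posDef B⟩

/-- The Riemannian metric
`d_R(A, B) = (∑ j, (log λ_j (A^{-1/2} B A^{-1/2}))^2)^{1/2}`. -/
def dR (A B : PDCone m) : ℝ :=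
  √(∑ j, (Real.log ((conj_posDef A.sqrtMat_posDef.inv B).isHermitian.eigenvalues j)) ^ 2)

/-- The partial products `S_1 = x_1`, `S_{j+1} = S_j ∘ x_{j+1}` (with `S_0 = I` by convention). -/
def walk (x : ℕ → PDCone m) : ℕ → PDCone m
  | 0 => one m
  | 1 => x 1
  | (j + 2) => comp (walk x (j + 1)) (x (j + 2))

/-- `U_n = max {d_R(I, S_1), …, d_R(I, S_n)}`, for `n ≥ 1`. -/
def maxDist (x : ℕ → PDCone m) (n : ℕ) (hn : 1 ≤ n) : ℝ :=
  (Finset.Icc 1 n).sup' (Finset.nonempty_Icc.mpr hn) (fun j => dR (one m) (walk x j))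

/-- The entries `a_{ij}`, `i ≤ j`, of a point of the cone. -/
def upperEntries (A : PDCone m) : {p : Fin m × Fin m // p.1 ≤ p.2} → ℝ :=
  fun p => A.mat p.1.1 p.1.2

theorem mat_eq_of_le (A : PDCone m) (i j : Fin m) :
    A.mat i j = A.upperEntries ⟨(min i j, max i j), min_le_max⟩ := by
  rcases le_total i j with h | h
  · simp [upperEntries, h]
  · have := A.2.isHermitian.apply i j
    simp only [star_trivial] at this
    simp [upperEntries, h, mat, this]

/-- The symmetric matrix with prescribed entries on and above the diagonal. -/
def symMat (v : {p : Fin m × Fin m // p.1 ≤ p.2} → ℝ) : Matrix (Fin m) (Fin m) ℝ :=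
  Matrix.of fun i j => v ⟨(min i j, max i j), min_le_max⟩

theorem continuous_symMat : Continuous (symMat (m := m)) :=
  continuous_pi fun _ => continuous_pi fun _ => continuous_apply _

theorem symMat_upperEntries (A : PDCone m) : symMat A.upperEntries = A.mat := by
  ext i j
  exact (mat_eq_of_le A i j).symm

theorem upperEntries_symMat (v : {p : Fin m × Fin m // p.1 ≤ p.2} → ℝ) (h : (symMat v).PosDef) :
    upperEntries ⟨symMat v, h⟩ = v := by
  ext ⟨⟨i, j⟩, hij⟩
  simp only at hij
  simp [upperEntries, mat, symMat, hij]

theorem continuous_mat : Continuous (mat (m := m)) :=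
  continuous_induced_dom

theorem continuous_upperEntries : Continuous (upperEntries (m := m)) :=
  continuous_pi fun p => continuous_mat.matrix_elem p.1.1 p.1.2

theorem isEmbedding_upperEntries : Topology.IsEmbedding (upperEntries (m := m)) := by
  refine Topology.IsEmbedding.of_comp continuous_upperEntries continuous_symMat ?_
  have h : symMat ∘ upperEntries = mat (m := m) := funext symMat_upperEntries
  rw [h]
  exact Topology.IsEmbedding.subtypeVal

theorem measurableSet_range_upperEntries :
    MeasurableSet (Set.range (upperEntries (m := m))) := by
  have h : Set.range (upperEntries (m := m)) =
      (⋂ x : Fin m → ℝ, {v | 0 ≤ x ⬝ᵥ ((symMat v).mulVec x)}) ∩ {v | (symMat v).det ≠ 0} := by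
    ext v
    simp only [Set.mem_range, Set.mem_inter_iff, Set.mem_iInter, Set.mem_ofPred_eq]
    constructor
    · rintro ⟨A, rfl⟩
      rw [symMat_upperEntries]
      exact ⟨fun x => by simpa [mat] using A.2.posSemidef.dotProduct_mulVec_nonneg x, A.2.det_pos.ne'⟩
    · rintro ⟨h1, h2⟩
      have hH : (symMat v).IsHermitian := by
        ext i j
        simp [symMat, min_comm, max_comm]
      have hS : (symMat v).PosSemidef :=
        Matrix.PosSemidef.of_dotProduct_mulVec_nonneg hH fun x => by simpa using h1 x
      exact ⟨⟨symMat v, hS.posDef_iff_det_ne_zero.mpr h2⟩, upperEntries_symMat v _⟩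
  rw [h]
  refine MeasurableSet.inter (IsClosed.measurableSet (isClosed_iInter fun x => ?_))
    (IsOpen.measurableSet ?_)
  · exact isClosed_le continuous_const
      (continuous_const.dotProduct (continuous_symMat.matrix_mulVec continuous_const))
  · exact isOpen_ne_fun continuous_symMat.matrix_det continuous_const

/-- The cone is a measurable subset of the space of upper triangular coordinates. -/
theorem measurableEmbedding_upperEntries : MeasurableEmbedding (upperEntries (m := m)) :=
  isEmbedding_upperEntries.measurableEmbedding measurableSet_range_upperEntries

/-- Lebesgue measure `dx = ∏_{i ≤ j} dx_{ij}` on the cone. -/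
def lebesgue (m : ℕ) : Measure (PDCone m) := (volume).comap upperEntries

end PDCone

/-- The multivariate gamma function `Γ_m(a)`. -/
def multivariateGamma (m : ℕ) (a : ℝ) : ℝ :=
  Real.pi ^ ((m : ℝ) * ((m : ℝ) - 1) / 4) *
    ∏ j ∈ Finset.Icc 1 m, Real.Gamma (a - ((j : ℝ) - 1) / 2)

/-- The Wishart density with respect to Lebesgue measure on the cone. -/
def wishartPDF (m : ℕ) (a : ℝ) (x : PDCone m) : ℝ :=
  1 / (2 ^ ((m : ℝ) * a) * multivariateGamma m a) *
    x.mat.det ^ (a - ((m : ℝ) + 1) / 2) * Real.exp (-(x.mat.trace) / 2)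

/-- The Wishart distribution `W_m(a, I_m)`, for `a > (m - 1) / 2`. -/
def wishart (m : ℕ) (a : ℝ) : Measure (PDCone m) :=
  (PDCone.lebesgue m).withDensity (fun x => ENNReal.ofReal (wishartPDF m a x))

/-- The chi-squared distribution with `k > 0` degrees of freedom: the gamma distribution of
shape `k / 2` and rate `1 / 2`. -/
def chiSquared (k : ℝ) : Measure ℝ := gammaMeasure (k / 2) (1 / 2)

end

/-!
Since `d_R(I, S)² = ∑ (log λ_i(S))²`, the Cauchy-Schwarz inequality gives
`log (det S) ≤ √m d_R(I, S)`. Determinants are multiplicative along the walk, so `U_n ≤ t` forces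
`∏_{i ≤ j} m (det X_i) ^ (1 / m) ≤ m ^ j exp (t / √m)` for every `j ≤ n`. It remains to compare
`ψ(X) = m (det X) ^ (1 / m)`, for one Wishart matrix `X`, with a chi-squared variable `R`: stochastic
domination of independent positive factors passes to products (`measure_finsetProd_le_of_cdf_le`).

The comparison (`wishart_scaledDet_le_chiSquared`) rests on the invariance of Lebesgue measure under
translation. The functional `ψ` satisfies `ψ(A + s I) ≥ ψ(A) + m s`, while `A ↦ A + s I` multiplies
`exp (-tr A / 2)` by `exp (-m s / 2)`. Hence the tail `H r` of `ψ` under the measure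
`exp (-tr A / 2) dA` is such that `exp (r / 2) * H r` is nondecreasing. The Wishart law has density
proportional to `ψ ^ α` with respect to that measure, `2 α = (2 a - m - 1) m`, so by the layer-cake
formula the law of `ψ(X)` dominates the probability measure with density proportional to
`r ^ (α - 1) * H r`. The latter has a nondecreasing density with respect to the gamma distribution of
shape `α` and rate `1 / 2`, which is the law of `R`, and therefore dominates it
(`withDensity_rpow_le_gammaMeasure`). The distribution of the determinant is not needed.
-/

/-! ### Comparison with the gamma distribution -/

/-- Reweighting a probability measure on the line by a nondecreasing density moves mass to the
right. -/
theorem setLIntegral_Iic_le_of_monotone {γ : Measure ℝ} [IsProbabilityMeasure γ] {k : ℝ → ℝ≥0∞}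
    (hk : Monotone k) (h1 : ∫⁻ x, k x ∂γ = 1) (c : ℝ) :
    ∫⁻ x in Set.Iic c, k x ∂γ ≤ γ (Set.Iic c) := by
  rcases le_total (k c) 1 with hc | hc
  · calc ∫⁻ x in Set.Iic c, k x ∂γ ≤ ∫⁻ _ in Set.Iic c, 1 ∂γ :=
          setLIntegral_mono measurable_const fun x hx => (hk hx).trans hc
      _ = γ (Set.Iic c) := setLIntegral_one _
  · have hsplit : ∫⁻ x in Set.Iic c, k x ∂γ + ∫⁻ x in Set.Ioi c, k x ∂γ = 1 := by
      rw [← h1, ← Set.compl_Iic, lintegral_add_compl k measurableSet_Iic]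
    have hγ : γ (Set.Iic c) + γ (Set.Ioi c) = 1 := by
      rw [← Set.compl_Iic, prob_add_prob_compl measurableSet_Iic]
    have hlow : γ (Set.Ioi c) ≤ ∫⁻ x in Set.Ioi c, k x ∂γ :=
      calc γ (Set.Ioi c) = ∫⁻ _ in Set.Ioi c, 1 ∂γ := (setLIntegral_one _).symm
        _ ≤ ∫⁻ x in Set.Ioi c, k x ∂γ :=
          setLIntegral_mono hk.measurable fun x hx => hc.trans (hk (le_of_lt hx))
    refine (ENNReal.add_le_add_iff_right (measure_ne_top γ (Set.Ioi c))).mp ?_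
    rw [hγ, ← hsplit]
    gcongr

theorem ae_pos_gammaMeasure (a r : ℝ) : ∀ᵐ x ∂gammaMeasure a r, 0 < x := by
  have h : gammaMeasure a r (Set.Iic 0) = 0 := by
    rw [gammaMeasure, withDensity_apply _ measurableSet_Iic,
      setLIntegral_congr Iio_ae_eq_Iic.symm, lintegral_gammaPDF_of_nonpos le_rfl]
  rw [ae_iff]
  simpa [Set.Iic] using h

/-- If the tail `H r = μ {r < ψ}` decays no faster than `exp (-b r)`, then `ψ` under the probability
measure proportional to `ψ ^ α • μ` is stochastically at least a gamma variable of shape `α` and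
rate `b`. By the layer-cake formula the total mass is proportional to `∫ r ^ (α - 1) * H r dr`, and
`H r` is `exp (-b r)` times a nondecreasing function. -/
theorem withDensity_rpow_le_gammaMeasure {E : Type*} [MeasurableSpace E] {μ : Measure E}
    {ψ : E → ℝ} (hψ : Measurable ψ) (hψ0 : ∀ x, 0 ≤ ψ x) {α b : ℝ} (hα : 0 < α) (hb : 0 < b)
    (hH : ∀ r, 0 < r → ∀ u, 0 ≤ u →
      ENNReal.ofReal (Real.exp (-(b * u))) * μ {x | r < ψ x} ≤ μ {x | r + u < ψ x})
    {C : ℝ≥0∞} (hν : IsProbabilityMeasure (μ.withDensity fun x => C * ENNReal.ofReal (ψ x ^ α)))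
    (c : ℝ) :
    (μ.withDensity fun x => C * ENNReal.ofReal (ψ x ^ α)) {x | ψ x ≤ c} ≤
      gammaMeasure α b (Set.Iic c) := by
  have hprob := isProbabilityMeasure_gammaMeasure hα hb
  set H : ℝ → ℝ≥0∞ := fun r => μ {x | r < ψ x} with hHdef
  have hHanti : Antitone H := fun r s hrs => measure_mono fun x hx => lt_of_le_of_lt hrs hx
  -- `k` is the ratio of the density proportional to `r ^ (α - 1) * H r` to the gamma density.
  set k : ℝ → ℝ≥0∞ := fun r => if r ≤ 0 then 0 else
    C * ENNReal.ofReal (α * Real.Gamma α / b ^ α) * (ENNReal.ofReal (Real.exp (b * r)) * H r)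
    with hk
  have hkmono : Monotone k := by
    intro r s hrs
    rcases le_or_gt r 0 with hr | hr
    · simp [hk, hr]
    have hs : 0 < s := hr.trans_le hrs
    simp only [hk, not_le.mpr hr, not_le.mpr hs, if_false]
    have h := hH r hr (s - r) (sub_nonneg.mpr hrs)
    rw [add_sub_cancel] at h
    refine mul_le_mul_right ?_ _
    calc ENNReal.ofReal (Real.exp (b * r)) * H r
        = ENNReal.ofReal (Real.exp (b * s)) *
            (ENNReal.ofReal (Real.exp (-(b * (s - r)))) * H r) := by
          rw [← mul_assoc, ← ENNReal.ofReal_mul (Real.exp_nonneg _), ← Real.exp_add]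
          ring_nf
      _ ≤ ENNReal.ofReal (Real.exp (b * s)) * H s := mul_le_mul_right h _
  have hΓ := Real.Gamma_pos_of_pos hα
  have hbα := Real.rpow_pos_of_pos hb α
  have hkpdf : ∀ r, 0 < r → gammaPDF α b r * k r =
      C * ENNReal.ofReal α * (H r * ENNReal.ofReal (r ^ (α - 1))) := by
    intro r hr
    have hr' := Real.rpow_pos_of_pos hr (α - 1)
    simp only [hk, not_le.mpr hr, if_false]
    rw [gammaPDF_of_nonneg hr.le]
    have e : ENNReal.ofReal α * ENNReal.ofReal (r ^ (α - 1)) =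
        ENNReal.ofReal (b ^ α / Real.Gamma α * r ^ (α - 1) * Real.exp (-(b * r))) *
          ENNReal.ofReal (α * Real.Gamma α / b ^ α) * ENNReal.ofReal (Real.exp (b * r)) := by
      rw [← ENNReal.ofReal_mul hα.le, ← ENNReal.ofReal_mul (by positivity),
        ← ENNReal.ofReal_mul (by positivity)]
      congr 1
      rw [Real.exp_neg]
      field_simp
    calc _ = C * (ENNReal.ofReal (b ^ α / Real.Gamma α * r ^ (α - 1) * Real.exp (-(b * r))) *
          ENNReal.ofReal (α * Real.Gamma α / b ^ α) * ENNReal.ofReal (Real.exp (b * r))) * H r := by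
          ring
      _ = _ := by rw [← e]; ring
  have hpdf : Measurable (gammaPDF α b) := (measurable_gammaPDFReal α b).ennreal_ofReal
  -- Both the total mass and the distribution function of `k • gammaMeasure α b` become integrals of
  -- the tail `H`, which is the form the layer-cake formula produces.
  have hint : ∀ S : Set ℝ, MeasurableSet S → ∫⁻ r in S, k r ∂gammaMeasure α b =
      C * ENNReal.ofReal α *
        ∫⁻ r in Set.Ioi 0, S.indicator (fun r => H r * ENNReal.ofReal (r ^ (α - 1))) r := by
    intro S hS
    have hmeas : Measurable (S.indicator fun r => H r * ENNReal.ofReal (r ^ (α - 1))) :=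
      (hHanti.measurable.mul (by fun_prop)).indicator hS
    rw [gammaMeasure, setLIntegral_withDensity_eq_setLIntegral_mul _ hpdf hkmono.measurable hS,
      ← lintegral_const_mul _ hmeas, ← lintegral_indicator hS, ← lintegral_indicator measurableSet_Ioi]
    congr 1
    ext r
    by_cases hrS : r ∈ S <;> rcases le_or_gt r 0 with hr | hr
    · simp [hrS, hr, hk]
    · simp [hrS, hr, hkpdf r hr]
    · simp [hrS, hr]
    · simp [hrS, hr]
  have hψα : Measurable fun x => ENNReal.ofReal (ψ x ^ α) := (hψ.pow_const α).ennreal_ofReal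
  have h1 : ∫⁻ r, k r ∂gammaMeasure α b = 1 := by
    rw [← setLIntegral_univ, hint _ MeasurableSet.univ]
    have := hν.measure_univ
    rw [withDensity_apply _ MeasurableSet.univ, setLIntegral_univ, lintegral_const_mul _ hψα,
      lintegral_rpow_eq_lintegral_meas_lt_mul μ (Filter.Eventually.of_forall hψ0)
        hψ.aemeasurable hα, ← mul_assoc] at this
    simpa using this
  refine le_trans ?_ (setLIntegral_Iic_le_of_monotone hkmono h1 c)
  have hSc : MeasurableSet {x | ψ x ≤ c} := measurableSet_le hψ measurable_const
  -- Restricting `μ` to `{ψ ≤ c}` replaces `H r` by `μ {r < ψ ≤ c}`: it vanishes for `r > c` and is at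
  -- most `H r` otherwise. The boundary term dropped here makes this an inequality.
  rw [withDensity_apply _ hSc, lintegral_const_mul _ hψα,
    lintegral_rpow_eq_lintegral_meas_lt_mul _ (Filter.Eventually.of_forall hψ0)
        hψ.aemeasurable hα, ← mul_assoc, hint _ measurableSet_Iic]
  gcongr with r
  rw [Measure.restrict_apply (measurableSet_lt measurable_const hψ)]
  by_cases hr : r ≤ c
  · rw [Set.indicator_of_mem (show r ∈ Set.Iic c from hr)]
    gcongr
    exact measure_mono Set.inter_subset_left
  · have : {x | r < ψ x} ∩ {x | ψ x ≤ c} = ∅ := by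
      ext x
      simp only [Set.mem_inter_iff, Set.mem_ofPred_eq, Set.mem_empty_iff_false, iff_false]
      intro h
      exact hr (h.1.le.trans h.2)
    simp [this]

/-! ### Stochastic order for products of independent variables -/

/-- The product of two independent variables is monotone in each factor for the usual stochastic
order. The factors are replaced one at a time, so only `μ₂` and `ν₁` have to be carried by the
positive half-line. -/
theorem prod_mul_le_of_cdf_le {μ₁ μ₂ ν₁ ν₂ : Measure ℝ} [IsProbabilityMeasure μ₁]
    [IsProbabilityMeasure μ₂] [IsProbabilityMeasure ν₁] [IsProbabilityMeasure ν₂]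
    (hμ₂ : ∀ᵐ y ∂μ₂, 0 < y) (hν₁ : ∀ᵐ x ∂ν₁, 0 < x)
    (h₁ : ∀ c, μ₁ (Set.Iic c) ≤ ν₁ (Set.Iic c)) (h₂ : ∀ c, μ₂ (Set.Iic c) ≤ ν₂ (Set.Iic c))
    (c : ℝ) :
    (μ₁.prod μ₂) {p | p.1 * p.2 ≤ c} ≤ (ν₁.prod ν₂) {p | p.1 * p.2 ≤ c} := by
  have hS : MeasurableSet {p : ℝ × ℝ | p.1 * p.2 ≤ c} :=
    measurableSet_le (by fun_prop) measurable_const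
  calc (μ₁.prod μ₂) {p | p.1 * p.2 ≤ c}
      ≤ (ν₁.prod μ₂) {p | p.1 * p.2 ≤ c} := by
        rw [Measure.prod_apply_symm hS, Measure.prod_apply_symm hS]
        refine lintegral_mono_ae ?_
        filter_upwards [hμ₂] with y hy
        have : (fun x => (x, y)) ⁻¹' {p : ℝ × ℝ | p.1 * p.2 ≤ c} = Set.Iic (c / y) := by
          ext x
          simp [le_div_iff₀ hy]
        rw [this]
        exact h₁ _
    _ ≤ (ν₁.prod ν₂) {p | p.1 * p.2 ≤ c} := by
        rw [Measure.prod_apply hS, Measure.prod_apply hS]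
        refine lintegral_mono_ae ?_
        filter_upwards [hν₁] with x hx
        have : Prod.mk x ⁻¹' {p : ℝ × ℝ | p.1 * p.2 ≤ c} = Set.Iic (c / x) := by
          ext y
          simp [le_div_iff₀' hx]
        rw [this]
        exact h₂ _

theorem map_mul_Iic_of_indepFun {Ω : Type*} [MeasurableSpace Ω] {P : Measure Ω}
    [IsProbabilityMeasure P] {f g : Ω → ℝ} (hf : AEMeasurable f P) (hg : AEMeasurable g P)
    (hfg : IndepFun f g P) (c : ℝ) :
    P {ω | f ω * g ω ≤ c} = ((P.map f).prod (P.map g)) {p | p.1 * p.2 ≤ c} := by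
  have hS : MeasurableSet {p : ℝ × ℝ | p.1 * p.2 ≤ c} :=
    measurableSet_le (by fun_prop) measurable_const
  rw [← (indepFun_iff_map_prod_eq_prod_map_map hf hg).mp hfg,
    Measure.map_apply_of_aemeasurable (hf.prodMk hg) hS]
  rfl

/-- Stochastic domination of positive independent factors passes to their product. -/
theorem measure_finsetProd_le_of_cdf_le {ι Ω Ω' : Type*} [MeasurableSpace Ω] {P : Measure Ω}
    [IsProbabilityMeasure P] [MeasurableSpace Ω'] {Q : Measure Ω'} [IsProbabilityMeasure Q]
    {Y : ι → Ω → ℝ} {R : ι → Ω' → ℝ} (hY : ∀ i, AEMeasurable (Y i) P)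
    (hR : ∀ i, AEMeasurable (R i) Q) (hY0 : ∀ i, ∀ᵐ ω ∂P, 0 < Y i ω)
    (hR0 : ∀ i, ∀ᵐ ω ∂Q, 0 < R i ω) (hYi : iIndepFun Y P) (hRi : iIndepFun R Q)
    (h : ∀ i c, P {ω | Y i ω ≤ c} ≤ Q {ω | R i ω ≤ c}) (s : Finset ι) :
    ∀ c, P {ω | ∏ i ∈ s, Y i ω ≤ c} ≤ Q {ω | ∏ i ∈ s, R i ω ≤ c} := by
  classical
  induction s using Finset.induction_on with
  | empty =>
    intro c
    by_cases hc : 1 ≤ c <;> simp [hc]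
  | insert i s hi ih =>
    intro c
    have hYs : AEMeasurable (∏ j ∈ s, Y j) P := Finset.aemeasurable_prod _ fun j _ => hY j
    have hRs : AEMeasurable (∏ j ∈ s, R j) Q := Finset.aemeasurable_prod _ fun j _ => hR j
    have e1 := map_mul_Iic_of_indepFun hYs (hY i) (hYi.indepFun_finsetProd_of_notMem₀ hY hi) c
    have e2 := map_mul_Iic_of_indepFun hRs (hR i) (hRi.indepFun_finsetProd_of_notMem₀ hR hi) c
    simp only [Finset.prod_apply] at e1 e2
    simp only [Finset.prod_insert hi, mul_comm (Y i _), mul_comm (R i _)]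
    rw [e1, e2]
    have := Measure.isProbabilityMeasure_map hYs
    have := Measure.isProbabilityMeasure_map hRs
    have := Measure.isProbabilityMeasure_map (hY i)
    have := Measure.isProbabilityMeasure_map (hR i)
    refine prod_mul_le_of_cdf_le ?_ ?_ (fun c => ?_) (fun c => ?_) c
    · exact (ae_map_iff (hY i) measurableSet_Ioi).mpr (hY0 i)
    · refine (ae_map_iff hRs measurableSet_Ioi).mpr ?_
      filter_upwards [(Finset.eventually_all s).mpr fun j _ => hR0 j] with ω hω
      simpa using Finset.prod_pos hω
    · rw [Measure.map_apply_of_aemeasurable hYs measurableSet_Iic,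
        Measure.map_apply_of_aemeasurable hRs measurableSet_Iic]
      simpa [Set.preimage, Set.mem_Iic] using ih c
    · rw [Measure.map_apply_of_aemeasurable (hY i) measurableSet_Iic,
        Measure.map_apply_of_aemeasurable (hR i) measurableSet_Iic]
      exact h i c

/-! ### The determinant under translation by multiples of the identity -/

theorem Matrix.IsHermitian.det_add_smul_one {m : ℕ} {A : Matrix (Fin m) (Fin m) ℝ}
    (hA : A.IsHermitian) (s : ℝ) :
    (A + s • (1 : Matrix (Fin m) (Fin m) ℝ)).det = ∏ i, (hA.eigenvalues i + s) := by
  have h := congrArg (Polynomial.eval (-s)) hA.charpoly_eq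
  rw [Matrix.eval_charpoly, Polynomial.eval_prod] at h
  have e : Matrix.scalar (Fin m) (-s) - A = -(A + s • (1 : Matrix (Fin m) (Fin m) ℝ)) := by
    rw [Matrix.scalar_apply, ← Matrix.smul_one_eq_diagonal, neg_smul]
    abel
  have e' : ∀ i, Polynomial.eval (-s)
      (Polynomial.X - Polynomial.C ((hA.eigenvalues i : ℝ) : ℝ)) =
      -1 * (hA.eigenvalues i + s) := by
    intro i
    simp
    ring
  rw [e, Matrix.det_neg] at h
  simp only [RCLike.ofReal_real_eq_id, id_eq, e', Finset.prod_mul_distrib, Finset.prod_const,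
    Finset.card_univ] at h
  exact mul_left_cancel₀ (pow_ne_zero _ (by norm_num)) h

/-- Superadditivity of the geometric mean along constants: apply the arithmetic-geometric mean
inequality to `x i / (x i + s)` and to `s / (x i + s)`, and add. -/
theorem prod_rpow_inv_add_le {m : ℕ} (hm : 1 ≤ m) {x : Fin m → ℝ} (hx : ∀ i, 0 < x i) {s : ℝ}
    (hs : 0 ≤ s) :
    (∏ i, x i) ^ (1 / (m : ℝ)) + s ≤ (∏ i, (x i + s)) ^ (1 / (m : ℝ)) := by
  have hm0 : (m : ℝ) ≠ 0 := by positivity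
  have hxs : ∀ i, 0 < x i + s := fun i => add_pos_of_pos_of_nonneg (hx i) hs
  have hw : ∑ _i : Fin m, (1 / (m : ℝ)) = 1 := by simp [hm0]
  have amgm : ∀ z : Fin m → ℝ, (∀ i, 0 ≤ z i) →
      (∏ i, z i) ^ (1 / (m : ℝ)) ≤ ∑ i, 1 / (m : ℝ) * z i := fun z hz => by
    rw [← Real.finsetProd_rpow _ _ fun i _ => hz i]
    exact Real.geom_mean_le_arith_mean_weighted Finset.univ (fun _ => 1 / (m : ℝ)) z
      (fun _ _ => by positivity) hw fun i _ => hz i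
  have h1 := amgm (fun i => x i / (x i + s)) fun i => (div_pos (hx i) (hxs i)).le
  have h2 := amgm (fun i => s / (x i + s)) fun i => div_nonneg hs (hxs i).le
  have h3 : ∑ i, 1 / (m : ℝ) * (x i / (x i + s)) + ∑ i, 1 / (m : ℝ) * (s / (x i + s)) = 1 := by
    rw [← Finset.sum_add_distrib]
    refine (Finset.sum_congr rfl fun i _ => ?_).trans hw
    rw [← mul_add, ← add_div, div_self (hxs i).ne', mul_one]
  have hpos : 0 < (∏ i, (x i + s)) ^ (1 / (m : ℝ)) :=
    Real.rpow_pos_of_pos (Finset.prod_pos fun i _ => hxs i) _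
  have hs' : (∏ _i : Fin m, s) ^ (1 / (m : ℝ)) = s := by
    rw [Finset.prod_const, Finset.card_univ, Fintype.card_fin, one_div,
      Real.pow_rpow_inv_natCast hs (by omega)]
  rw [Finset.prod_div_distrib, Real.div_rpow (Finset.prod_nonneg fun i _ => (hx i).le)
    (Finset.prod_nonneg fun i _ => (hxs i).le)] at h1
  rw [Finset.prod_div_distrib, Real.div_rpow (Finset.prod_nonneg fun i _ => hs)
    (Finset.prod_nonneg fun i _ => (hxs i).le), hs'] at h2
  rw [← div_le_one hpos, add_div]
  linarith

namespace PDCone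
variable {m : ℕ}

/-- The functional `A ↦ m (det A) ^ (1 / m)`. The factor `m` gives it slope at least `m`, that of
the trace, along the identity. -/
noncomputable def scaledDet (A : PDCone m) : ℝ := m * A.mat.det ^ (1 / (m : ℝ))

/-- The translation `A ↦ A + s I` of the cone into itself, for `s ≥ 0`. -/
noncomputable def shift (s : ℝ) (hs : 0 ≤ s) (A : PDCone m) : PDCone m :=
  ⟨A.mat + s • 1, A.2.add_posSemidef (Matrix.PosSemidef.one.smul hs)⟩

theorem mat_shift (s : ℝ) (hs : 0 ≤ s) (A : PDCone m) : (shift s hs A).mat = A.mat + s • 1 := rfl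

theorem det_pos (A : PDCone m) : 0 < A.mat.det := A.2.det_pos

theorem scaledDet_pos (hm : 1 ≤ m) (A : PDCone m) : 0 < A.scaledDet :=
  mul_pos (by positivity) (Real.rpow_pos_of_pos A.det_pos _)

theorem measurable_scaledDet : Measurable (scaledDet (m := m)) :=
  ((continuous_mat.matrix_det).measurable.pow_const _).const_mul _

theorem scaledDet_add_le_shift (hm : 1 ≤ m) (s : ℝ) (hs : 0 ≤ s) (A : PDCone m) :
    A.scaledDet + m * s ≤ (shift s hs A).scaledDet := by
  have hA : A.mat.PosDef := A.2
  rw [scaledDet, scaledDet, mat_shift, hA.isHermitian.det_add_smul_one,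
    hA.isHermitian.det_eq_prod_eigenvalues, ← mul_add]
  gcongr
  simpa using prod_rpow_inv_add_le hm hA.eigenvalues_pos hs

theorem trace_shift (s : ℝ) (hs : 0 ≤ s) (A : PDCone m) :
    (shift s hs A).mat.trace = A.mat.trace + m * s := by
  simp [mat_shift, Matrix.trace_add, Matrix.trace_smul, mul_comm]

theorem upperEntries_shift (s : ℝ) (hs : 0 ≤ s) (A : PDCone m) :
    (shift s hs A).upperEntries =
      A.upperEntries + fun p => s * (1 : Matrix (Fin m) (Fin m) ℝ) p.1.1 p.1.2 := by
  ext p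
  simp [upperEntries, mat_shift]

/-! ### The Wishart measure under translation -/

/-- Lebesgue measure on the cone does not increase under pullback along `A ↦ A + s I`: in the upper
triangular coordinates this is a translation, and it maps the cone into itself. -/
theorem lintegral_shift_le (s : ℝ) (hs : 0 ≤ s) {f : PDCone m → ℝ≥0∞} (hf : Measurable f) :
    ∫⁻ A, f (shift s hs A) ∂lebesgue m ≤ ∫⁻ A, f A ∂lebesgue m := by
  have hemb := measurableEmbedding_upperEntries (m := m)
  -- `F` is `f` in coordinates, extended by zero off the cone.
  set F : ({p : Fin m × Fin m // p.1 ≤ p.2} → ℝ) → ℝ≥0∞ :=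
    Function.extend upperEntries f fun _ => 0 with hF
  have hFm : Measurable F := hemb.measurable_extend hf measurable_const
  have hFf : ∀ A : PDCone m, F A.upperEntries = f A := fun A => hemb.injective.extend_apply f _ A
  have hF0 : ∀ v, v ∉ Set.range (upperEntries (m := m)) → F v = 0 := fun v hv =>
    Function.extend_apply' f _ v hv
  set e : {p : Fin m × Fin m // p.1 ≤ p.2} → ℝ :=
    fun p => s * (1 : Matrix (Fin m) (Fin m) ℝ) p.1.1 p.1.2
  have key : ∀ g : ({p : Fin m × Fin m // p.1 ≤ p.2} → ℝ) → ℝ≥0∞,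
      ∫⁻ A, g (upperEntries A) ∂lebesgue m = ∫⁻ v in Set.range (upperEntries (m := m)), g v := by
    intro g
    rw [lebesgue, ← hemb.lintegral_map, hemb.map_comap]
  calc ∫⁻ A, f (shift s hs A) ∂lebesgue m
      = ∫⁻ A, F (upperEntries A + e) ∂lebesgue m := by
        refine lintegral_congr fun A => ?_
        rw [← hFf, upperEntries_shift]
    _ = ∫⁻ v in Set.range (upperEntries (m := m)), F (v + e) := key fun v => F (v + e)
    _ ≤ ∫⁻ v, F (v + e) := setLIntegral_le_lintegral _ _
    _ = ∫⁻ v, F v := lintegral_add_right_eq_self F e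
    _ = ∫⁻ v in Set.range (upperEntries (m := m)), F v := by
        rw [← lintegral_indicator hemb.measurableSet_range]
        refine lintegral_congr fun v => ?_
        by_cases hv : v ∈ Set.range (upperEntries (m := m))
        · rw [Set.indicator_of_mem hv]
        · rw [Set.indicator_of_notMem hv, hF0 v hv]
    _ = ∫⁻ A, f A ∂lebesgue m := by simp only [← key, hFf]

/-- The unnormalized measure `exp (-tr A / 2) dA` on the cone. -/
noncomputable def expTraceMeasure (m : ℕ) : Measure (PDCone m) :=
  (lebesgue m).withDensity fun A => ENNReal.ofReal (Real.exp (-A.mat.trace / 2))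

theorem measurable_expTrace :
    Measurable fun A : PDCone m => ENNReal.ofReal (Real.exp (-A.mat.trace / 2)) := by
  have : Measurable fun A : PDCone m => A.mat.trace := continuous_mat.matrix_trace.measurable
  fun_prop

/-- The tail of `scaledDet` under `exp (-tr A / 2) dA` decays no faster than `exp (-u / 2)`: adding
`(u / m) I` raises `scaledDet` by at least `u`, and costs exactly the factor `exp (-u / 2)`. -/
theorem expTraceMeasure_scaledDet_gt (hm : 1 ≤ m) (r u : ℝ) (hu : 0 ≤ u) :
    ENNReal.ofReal (Real.exp (-(1 / 2 * u))) * expTraceMeasure m {A | r < A.scaledDet} ≤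
      expTraceMeasure m {A | r + u < A.scaledDet} := by
  have hm0 : (m : ℝ) ≠ 0 := by positivity
  have hS : ∀ c : ℝ, MeasurableSet {A : PDCone m | c < A.scaledDet} := fun c =>
    measurableSet_lt measurable_const measurable_scaledDet
  have hs : 0 ≤ u / m := by positivity
  rw [expTraceMeasure, withDensity_apply _ (hS _), withDensity_apply _ (hS _),
    ← lintegral_const_mul _ measurable_expTrace, ← lintegral_indicator (hS _),
    ← lintegral_indicator (hS _)]
  refine le_trans (lintegral_mono fun A => ?_)
    (lintegral_shift_le (u / m) hs (measurable_expTrace.indicator (hS (r + u))))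
  by_cases hA : A ∈ {A : PDCone m | r < A.scaledDet}
  swap
  · rw [Set.indicator_of_notMem hA]
    exact zero_le
  rw [Set.indicator_of_mem hA]
  have h := scaledDet_add_le_shift hm (u / m) hs A
  rw [mul_div_cancel₀ _ hm0] at h
  have hA' : shift (u / m) hs A ∈ {A : PDCone m | r + u < A.scaledDet} :=
    lt_of_lt_of_le (add_lt_add_left (show r < A.scaledDet from hA) u) h
  rw [Set.indicator_of_mem hA', trace_shift, mul_div_cancel₀ _ hm0,
    ← ENNReal.ofReal_mul (Real.exp_nonneg _), ← Real.exp_add]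
  apply le_of_eq
  ring_nf

/-- The determinant factor of the Wishart density is a power of `scaledDet`, whose exponent is half
the number of degrees of freedom of the chi-squared bound. -/
theorem wishart_eq_withDensity (hm : 1 ≤ m) (a : ℝ) :
    wishart m a = (expTraceMeasure m).withDensity fun A =>
      ENNReal.ofReal (1 / (2 ^ ((m : ℝ) * a) * multivariateGamma m a) *
        ((m : ℝ) ^ ((2 * a - m - 1) * m / 2))⁻¹) *
      ENNReal.ofReal (A.scaledDet ^ ((2 * a - m - 1) * m / 2)) := by
  have hm0 : (0 : ℝ) < m := by positivity
  rw [expTraceMeasure, ← withDensity_mul _ measurable_expTrace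
    (((measurable_scaledDet.pow_const _).ennreal_ofReal).const_mul _), wishart]
  congr 1
  ext A
  have hd := A.det_pos
  rw [Pi.mul_apply, ← ENNReal.ofReal_mul' (Real.rpow_nonneg (scaledDet_pos hm A).le _),
    ← ENNReal.ofReal_mul (Real.exp_nonneg _), wishartPDF, scaledDet,
    Real.mul_rpow hm0.le (Real.rpow_nonneg hd.le _), ← Real.rpow_mul hd.le]
  have e : 1 / (m : ℝ) * ((2 * a - m - 1) * m / 2) = a - (m + 1) / 2 := by
    field_simp
    ring
  rw [e]
  have := (Real.rpow_pos_of_pos hm0 ((2 * a - m - 1) * m / 2)).ne'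
  congr 1
  field_simp

/-! ### Determinant and distance along the walk -/

theorem det_comp (A B : PDCone m) : (comp A B).mat.det = A.mat.det * B.mat.det := by
  have h : A.sqrtMat * A.sqrtMat = A.mat :=
    CFC.sqrt_mul_sqrt_self A.mat (Matrix.nonneg_iff_posSemidef.mpr A.2.posSemidef)
  have e : (comp A B).mat = A.sqrtMat * B.mat * A.sqrtMat := rfl
  rw [e, Matrix.det_mul, Matrix.det_mul, ← h, Matrix.det_mul]
  ring

theorem det_walk (x : ℕ → PDCone m) :
    ∀ j, (walk x j).mat.det = ∏ i ∈ Finset.Icc 1 j, (x i).mat.det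
  | 0 => by simp [walk, one, mat]
  | 1 => by simp [walk]
  | j + 2 => by rw [walk, det_comp, det_walk x (j + 1), Finset.prod_Icc_succ_top (b := j + 1) (by omega)]

/-- Cauchy-Schwarz, since `log (det A)` is the sum of the logarithms of the eigenvalues. -/
theorem log_det_le_dR_one (A : PDCone m) :
    Real.log A.mat.det ≤ √m * dR (one m) A := by
  have h1 : (one m).sqrtMat⁻¹ = 1 := by
    have : (one m).sqrtMat = 1 := CFC.sqrt_one
    rw [this, inv_one]
  set B := (one m).sqrtMat⁻¹ * A.mat * (one m).sqrtMat⁻¹ with hB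
  have hBp : B.PosDef := conj_posDef (one m).sqrtMat_posDef.inv A
  have hdet : A.mat.det = ∏ i, hBp.isHermitian.eigenvalues i := by
    have : A.mat = B := by rw [hB, h1]; simp
    rw [this]
    simpa using hBp.isHermitian.det_eq_prod_eigenvalues
  have hdR : dR (one m) A = √(∑ i, Real.log (hBp.isHermitian.eigenvalues i) ^ 2) := rfl
  rw [hdet, Real.log_prod fun i _ => (hBp.eigenvalues_pos i).ne', hdR,
    ← Real.sqrt_mul (Nat.cast_nonneg m)]
  refine Real.le_sqrt_of_sq_le ?_
  simpa using sq_sum_le_card_mul_sum_sq (s := Finset.univ)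
    (f := fun i => Real.log (hBp.isHermitian.eigenvalues i))

theorem prod_scaledDet_le (hm : 1 ≤ m) (x : ℕ → PDCone m) (j : ℕ) {t : ℝ}
    (h : dR (one m) (walk x j) ≤ t) :
    ∏ i ∈ Finset.Icc 1 j, (x i).scaledDet ≤ (m : ℝ) ^ j * Real.exp (t / √m) := by
  have hm0 : (0 : ℝ) < m := by positivity
  have hd := (walk x j).det_pos
  simp only [scaledDet, Finset.prod_mul_distrib, Finset.prod_const, Nat.card_Icc,
    Nat.add_sub_cancel]
  rw [Real.finsetProd_rpow _ _ fun i _ => (x i).det_pos.le, ← det_walk]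
  gcongr
  rw [Real.rpow_def_of_pos hd]
  refine Real.exp_le_exp.mpr ?_
  calc Real.log (walk x j).mat.det * (1 / m) ≤ √m * t * (1 / m) := by
        gcongr
        exact (log_det_le_dR_one _).trans (by gcongr)
    _ = t / √m := by
        have := Real.sq_sqrt hm0.le
        have h' := (Real.sqrt_pos.mpr hm0).ne'
        rw [mul_one_div, div_eq_div_iff hm0.ne' h']
        linear_combination t * this

end PDCone

/-! ### The chi-squared bound -/

/-- The chi-squared distribution with `(2 a - m - 1) m` degrees of freedom lies stochastically below
the law of `m (det X) ^ (1 / m)`, for `X` with the Wishart distribution. -/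
theorem wishart_scaledDet_le_chiSquared {m : ℕ} (hm : 1 ≤ m) {a : ℝ} (ha : ((m : ℝ) + 1) / 2 < a)
    [hW : IsProbabilityMeasure (wishart m a)] (c : ℝ) :
    wishart m a {A | A.scaledDet ≤ c} ≤ chiSquared ((2 * a - m - 1) * m) (Set.Iic c) := by
  have hα : 0 < (2 * a - m - 1) * m / 2 := by
    have : (0 : ℝ) < m := by positivity
    have : 0 < 2 * a - m - 1 := by linarith
    positivity
  rw [PDCone.wishart_eq_withDensity hm] at hW ⊢
  exact withDensity_rpow_le_gammaMeasure PDCone.measurable_scaledDet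
    (fun A => (PDCone.scaledDet_pos hm A).le) hα one_half_pos
    (fun r _ u hu => PDCone.expTraceMeasure_scaledDet_gt hm r u hu) hW c

theorem proposition6
    {Ω : Type*} [MeasurableSpace Ω] (P : Measure Ω) [IsProbabilityMeasure P]
    {Ω' : Type*} [MeasurableSpace Ω'] (Q : Measure Ω') [IsProbabilityMeasure Q]
    (m n : ℕ) (hm : 1 ≤ m) (hn : 1 ≤ n) (a : ℝ) (ha : ((m : ℝ) + 1) / 2 < a)
    (X : ℕ → Ω → PDCone m)
    (hX_law : ∀ i ∈ Finset.Icc 1 n, HasLaw (X i) (wishart m a) P)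
    (hX_indep : iIndepFun (fun i : Finset.Icc 1 n => X i) P)
    (R : ℕ → Ω' → ℝ)
    (hR_law : ∀ i ∈ Finset.Icc 1 n, HasLaw (R i) (chiSquared ((2 * a - m - 1) * m)) Q)
    (hR_indep : iIndepFun (fun i : Finset.Icc 1 n => R i) Q)
    (t : ℝ) (ht : 0 < t) :
    P {ω | PDCone.maxDist (fun i => X i ω) n hn ≤ t} ≤
      (Finset.Icc 1 n).inf' (Finset.nonempty_Icc.mpr hn) (fun j =>
        Q {ω' | ∏ i ∈ Finset.Icc 1 j, R i ω' ≤ (m : ℝ) ^ j * Real.exp (t / √(m : ℝ))}) ∧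
    P {ω | PDCone.maxDist (fun i => X i ω) n hn ≤ t} ≤
      chiSquared ((2 * a - m - 1) * m) (Set.Iic ((m : ℝ) * Real.exp (t / √(m : ℝ)))) := by
  have hXI : ∀ i : Finset.Icc 1 n, HasLaw (X i) (wishart m a) P := fun i => hX_law i i.2
  have hRI : ∀ i : Finset.Icc 1 n, HasLaw (R i) (chiSquared ((2 * a - m - 1) * m)) Q :=
    fun i => hR_law i i.2
  have hone : 1 ∈ Finset.Icc 1 n := Finset.mem_Icc.mpr ⟨le_rfl, hn⟩
  -- The normalization of the Wishart density is inherited from the law of `X 1`.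
  have hW : IsProbabilityMeasure (wishart m a) := by
    rw [← (hX_law 1 hone).map_eq]
    exact Measure.isProbabilityMeasure_map (hX_law 1 hone).aemeasurable
  have hcdf : ∀ (i : Finset.Icc 1 n) (c : ℝ),
      P {ω | (X i ω).scaledDet ≤ c} ≤ Q {ω' | R i ω' ≤ c} := fun i c => by
    rw [(hXI i).measure_eq (p := fun A => A.scaledDet ≤ c)
        (measurableSet_le PDCone.measurable_scaledDet measurable_const),
      (hRI i).measure_eq (p := fun r => r ≤ c) measurableSet_Iic]
    exact wishart_scaledDet_le_chiSquared hm ha c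
  have key : ∀ j ∈ Finset.Icc 1 n, P {ω | PDCone.maxDist (fun i => X i ω) n hn ≤ t} ≤
      Q {ω' | ∏ i ∈ Finset.Icc 1 j, R i ω' ≤ (m : ℝ) ^ j * Real.exp (t / √(m : ℝ))} := by
    intro j hj
    have hsub : ∀ i ∈ Finset.Icc 1 j, i ∈ Finset.Icc 1 n :=
      Finset.Icc_subset_Icc_right (Finset.mem_Icc.mp hj).2
    have hprod := measure_finsetProd_le_of_cdf_le (P := P) (Q := Q)
      (Y := fun (i : Finset.Icc 1 n) ω => (X i ω).scaledDet) (R := fun i : Finset.Icc 1 n => R i)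
      (fun i => PDCone.measurable_scaledDet.comp_aemeasurable (hXI i).aemeasurable)
      (fun i => (hRI i).aemeasurable)
      (fun i => Filter.Eventually.of_forall fun ω => PDCone.scaledDet_pos hm _)
      (fun i => ae_of_ae_map (hRI i).aemeasurable <| by
        rw [(hRI i).map_eq]
        exact ae_pos_gammaMeasure _ _)
      (hX_indep.comp (fun _ => PDCone.scaledDet) fun _ => PDCone.measurable_scaledDet)
      hR_indep hcdf ((Finset.Icc 1 j).subtype (· ∈ Finset.Icc 1 n))
      ((m : ℝ) ^ j * Real.exp (t / √(m : ℝ)))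
    simp only [fun ω => Finset.prod_subtype_of_mem (fun i => (X i ω).scaledDet) hsub,
      fun ω' => Finset.prod_subtype_of_mem (fun i => R i ω') hsub] at hprod
    refine (measure_mono fun ω hω => ?_).trans hprod
    exact PDCone.prod_scaledDet_le hm (fun i => X i ω) j
      ((Finset.le_sup' (fun j => PDCone.dR (PDCone.one m) (PDCone.walk (fun i => X i ω) j))
        hj).trans hω)
  refine ⟨Finset.le_inf' _ _ key, (key 1 hone).trans_eq ?_⟩
  simp only [Finset.Icc_self, Finset.prod_singleton, pow_one]
  exact (hR_law 1 hone).measure_eq (p := fun r => r ≤ (m : ℝ) * Real.exp (t / √(m : ℝ)))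
    measurableSet_Iic
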